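/- Let $\Sigma=\{0,1\}$ and let $\Sigma^*$ be the set of finite binary strings. For $f:\Sigma^*\to\Sigma$ and $T\ge 1$, let $f^{\mathrm{CoT}\text{-}T}(x)$ be the string obtained from $x\in\Sigma^*$ by applying $T$ times the map $\bar f(x)=\mathrm{append}(x,f(x))$, and let $f^{\mathrm{e2e}\text{-}T}(x)$ be its last symbol. For $d\ge 1$ let $\mathcal F_{d,\mathrm{lin}}$ be the class of all functions $$f_{w,b}(x)=\mathbf 1\Big[\sum_{i=1}^{\min(d,|x|)} w[-i]\,x[-i]+b\ge 0\Big],\qquad w\in\mathbb R^d,\ b\in\mathbb R,$$ on $\Sigma^*$, where $v[-i]$ denotes the $i$-th entry of $v$ from the end. The class $\mathrm{e2e}^T(\mathcal F_{d,\mathrm{lin}})=\{f^{\mathrm{e2e}\text{-}T}:f\in\mathcal F_{d,\mathrm{lin}}\}$ is *e2e-learned* (respectively *CoT-learned*) by a rule $A$ with sample complexity $m(\varepsilon,\delta)\in\mathbb N$ if for every probability distribution $\mathcal D$ on $\Sigma^*$, every $f_*\in\mathcal F_{d,\mathrm{lin}}$ and all $0<\varepsilon,\delta<1$, with probability at least $1-\delta$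 over i.i.d. $x_1,\dots,x_m\sim\mathcal D$, $m=m(\varepsilon,\delta)$, the predictor $h=A(S):\Sigma^*\to\Sigma$ satisfies $\mathbb P_{x\sim\mathcal D}\big(h(x)\ne f_*^{\mathrm{e2e}\text{-}T}(x)\big)\le\varepsilon$; here $S=\big((x_i,f_*^{\mathrm{e2e}\text{-}T}(x_i))\big)_{i\le m}$ (respectively $S=\big(f_*^{\mathrm{CoT}\text{-}T}(x_i)\big)_{i\le m}$). It is e2e-learnable (CoT-learnable) with sample complexity $m$ if some rule does so. The rule $\mathrm{Cons}_{\mathrm{e2e}}$ returns, on a sample $S=((x_i,y_i))_i$, a function $\hat f^{\mathrm{e2e}\text{-}T}$ for some $\hat f\in\mathcal F_{d,\mathrm{lin}}$ with $\hat f^{\mathrm{e2e}\text{-}T}(x_i)=y_i$ for all $i$, whenever such an $\hat f$ exists; the rule $\mathrm{Cons}_{\mathrm{CoT}}$ returns, on a sample $S=(z_i)_i$, a function $\hat f^{\mathrm{e2e}\text{-}T}$ for some $\hat f\in\mathcal F_{d,\mathrm{lin}}$ with $\hat f^{\mathrm{CoT}\text{-}T}(x_i)=z_i$ for all $i$, where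 $x_i$ is $z_i$ without its last $T$ symbols, whenever such an $\hat f$ exists. In both cases the choice of $\hat f$, and the output when there is none, are arbitrary. **Theorem.** 1. For every $d\ge 1$, the number of distinct functions obtained by restricting the members of $\mathcal F_{d,\mathrm{lin}}$ to $\{0,1\}^d$ is at most $(2e\cdot 2^d)^{d+1}$, and this number is $2^{O(d^2)}$. 2. For all $d,T\ge 1$, $\mathrm{e2e}^T(\mathcal F_{d,\mathrm{lin}})$ is e2e-learnable, namely by every implementation of $\mathrm{Cons}_{\mathrm{e2e}}$, with a sample complexity $$m^{\mathrm{e2e}}(\varepsilon,\delta)=O\!\left(\frac{\min\{d^2,\ d\,T\log(2/\varepsilon)\}+\log(1/\delta)}{\varepsilon}\right).$$ 3. For all $d,T\ge 1$, $\mathrm{e2e}^T(\mathcal F_{d,\mathrm{lin}})$ is CoT-learnable, namely by every implementation of $\mathrm{Cons}_{\mathrm{CoT}}$, with a sample complexity $$m^{\mathrm{CoT}}(\varepsilon,\delta)=O\!\left(\frac{\min\{d^2,\ d\,\log(2T)\log(2/\varepsilon)\}+\log(1/\delta)}{\varepsilon}\right).$$ The constants in $O(\cdot)$ are absolute: they do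 not depend on $d$, $T$, $\varepsilon$, $\delta$, the distribution, the target or the implementation of the rule. -/

import Mathlib

open MeasureTheory

/-- Strings over the binary alphabet `{0, 1}`; the last token of the string is the last entry of
the list. -/
abbrev Str : Type := List Bool

/-- The set of all strings is countable, and every subset of it is an event. -/
instance instMeasurableSpaceStr : MeasurableSpace (List Bool) := ⊤

/-- A next-token generator. -/
abbrev Generator : Type := Str → Bool

/-- Apply-and-append: `x ↦ append(x, f x)`. -/
def applyAppend (f : Generator) (x : Str) : Str := x ++ [f x]

/-- The `T`-step Chain-of-Thought of `f` on `x`, a string of length `|x| + T`. -/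
def cot (f : Generator) (T : ℕ) (x : Str) : Str := (applyAppend f)^[T] x

/-- The end-to-end map: the last token of the Chain-of-Thought (the default value `false` plays
no role when `T ≥ 1`, since the Chain-of-Thought is then a nonempty string). -/
def ete (f : Generator) (T : ℕ) (x : Str) : Bool := (cot f T x).getLastD false

/-- The real number `0` or `1` that a token stands for. -/
def bit (c : Bool) : ℝ := if c then 1 else 0

open Classical in
/-- The linear threshold generator
`f_{w,b}(x) = 1[∑_{i=1}^{min(d,|x|)} w[-i] x[-i] + b ≥ 0]`.
For `i : Fin d`, `w i.rev` is `w[-(i+1)]` and `x.reverse.getD i false` is `x[-(i+1)]` if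
`i < |x|`; the terms with `i ≥ |x|` vanish. -/
noncomputable def linThreshold {d : ℕ} (w : Fin d → ℝ) (b : ℝ) : Generator := fun x =>
  decide (0 ≤ (∑ i : Fin d, w i.rev * bit (x.reverse.getD i false)) + b)

/-- The base class of `d`-dimensional linear thresholds. -/
def linClass (d : ℕ) : Set Generator :=
  {f | ∃ (w : Fin d → ℝ) (b : ℝ), f = linThreshold w b}

/-- The restriction of a class of generators to the domain `{0,1}^n`. -/
def restrictToLength (F : Set Generator) (n : ℕ) : Set (List.Vector Bool n → Bool) :=
  (fun (f : Generator) (x : List.Vector Bool n) => f x.toList) '' F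

/-- The population 0-1 error of the predictor `h` when the target is `ete f T`. -/
noncomputable def popError (D : Measure Str) (f : Generator) (T : ℕ) (h : Str → Bool) : ℝ :=
  D.real {x | h x ≠ ete f T x}

/-- A learning rule that sees inputs with final answers only. -/
abbrev E2ERule : Type := List (Str × Bool) → Str → Bool

/-- A learning rule that sees the strings `z = cot f T x`, that is, inputs followed by their
entire Chain-of-Thought. -/
abbrev CoTRule : Type := List Str → Str → Bool

/-- The training set of inputs `x i` with the final answers `ete f T (x i)`. -/
def e2eSample (f : Generator) (T : ℕ) {m : ℕ} (x : Fin m → Str) : List (Str × Bool) :=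
  List.ofFn fun i => (x i, ete f T (x i))

/-- The training set of the strings `cot f T (x i)`. -/
def cotSample (f : Generator) (T : ℕ) {m : ℕ} (x : Fin m → Str) : List Str :=
  List.ofFn fun i => cot f T (x i)

/-- The rule `A` learns `ete F T` from final answers with sample complexity `m`, in the realizable
setting. -/
def E2ELearnsWith (F : Set Generator) (T : ℕ) (A : E2ERule) (m : ℝ → ℝ → ℕ) : Prop :=
  ∀ (D : Measure Str) [IsProbabilityMeasure D], ∀ f ∈ F, ∀ ε δ : ℝ,
    0 < ε → ε < 1 → 0 < δ → δ < 1 →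
      1 - δ ≤ (Measure.pi fun _ : Fin (m ε δ) => D).real
        {x | popError D f T (A (e2eSample f T x)) ≤ ε}

/-- The rule `A` learns `ete F T` from entire Chains-of-Thought with sample complexity `m`, in the
realizable setting. The predictor is evaluated on the final answer only. -/
def CoTLearnsWith (F : Set Generator) (T : ℕ) (A : CoTRule) (m : ℝ → ℝ → ℕ) : Prop :=
  ∀ (D : Measure Str) [IsProbabilityMeasure D], ∀ f ∈ F, ∀ ε δ : ℝ,
    0 < ε → ε < 1 → 0 < δ → δ < 1 →
      1 - δ ≤ (Measure.pi fun _ : Fin (m ε δ) => D).real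
        {x | popError D f T (A (cotSample f T x)) ≤ ε}

/-- `ete F T` is e2e-learnable with sample complexity `m`. -/
def E2ELearnable (F : Set Generator) (T : ℕ) (m : ℝ → ℝ → ℕ) : Prop :=
  ∃ A : E2ERule, E2ELearnsWith F T A m

/-- `ete F T` is CoT-learnable with sample complexity `m`. -/
def CoTLearnable (F : Set Generator) (T : ℕ) (m : ℝ → ℝ → ℕ) : Prop :=
  ∃ A : CoTRule, CoTLearnsWith F T A m

/-- `f` agrees with all the final answers in `S`. -/
def E2EConsistent (f : Generator) (T : ℕ) (S : List (Str × Bool)) : Prop :=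
  ∀ p ∈ S, ete f T p.1 = p.2

/-- `f` generates every string `z` in `S` from its input, which is `z` without its last `T`
tokens. -/
def CoTConsistent (f : Generator) (T : ℕ) (S : List Str) : Prop :=
  ∀ z ∈ S, z = cot f T (z.take (z.length - T))

/-- `A` implements the rule `Cons_e2e`: on every training set that some member of `F` is
consistent with, it returns `ete g T` for some consistent `g ∈ F`. -/
def IsE2EConsRule (F : Set Generator) (T : ℕ) (A : E2ERule) : Prop :=
  ∀ S, (∃ f ∈ F, E2EConsistent f T S) → ∃ g ∈ F, E2EConsistent g T S ∧ A S = ete g T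

/-- `A` implements the rule `Cons_CoT`. -/
def IsCoTConsRule (F : Set Generator) (T : ℕ) (A : CoTRule) : Prop :=
  ∀ S, (∃ f ∈ F, CoTConsistent f T S) → ∃ g ∈ F, CoTConsistent g T S ∧ A S = ete g T

/-! A consistent rule fails only if the sample misses the error set of some member of the class
while that set has measure above `ε`. Two bounds on this event give the two terms of the minimum.
The `d ^ 2` term is a union bound: a threshold is determined by its values on the cube of length
`d`, so there are at most `2 ^ (8 * d ^ 2)` of them (`measureReal_exists_disjoint_le_of_finite`).
The other term is the `ε`-net theorem (`measureReal_exists_disjoint_le`), fed by the Sauer-Shelah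
bound for VC dimension at most `d + 1`. Whether a member errs on one input is settled by its values
on `N` strings. If whole chains are compared, the `T` prefixes of the target's chain suffice, so `N
= T`. If only answers are compared, every possible continuation is included, so `N = T * 2 ^ T`. The
growth bound costs `log (2 * N)` per dimension, which explains `log (2 * T)` against `T`. -/

/-! ### VC dimension and number of linear thresholds -/

section VCDimension

open Finset

open Classical in
/-- A family of `d + 2` points is never shattered by the linear thresholds in dimension `d`. -/
theorem card_le_of_forall_exists_linClass {ι : Type*} [Fintype ι] (φ : ι → Str) (d : ℕ)
    (h : ∀ P : ι → Prop, ∃ f ∈ linClass d, ∀ i, f (φ i) = true ↔ P i) :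
    Fintype.card ι ≤ d + 1 := by
  by_contra! hlt
  let v : ι → Option (Fin d) → ℝ := fun i o =>
    o.elim 1 fun j => bit ((φ i).reverse.getD j false)
  have hv : ¬ LinearIndependent ℝ v := fun hli => by
    have := hli.fintype_card_le_finrank
    simp at this
    omega
  obtain ⟨c, hc, i₀, hi₀⟩ := Fintype.not_linearIndependent_iff.1 hv
  have hcomp : ∀ o, ∑ i, c i * v i o = 0 := fun o => by
    simpa [Finset.sum_apply] using congrFun hc o
  have hsum : ∑ i, c i = 0 := by simpa [v] using hcomp none
  -- Label points by the sign of their coefficient in the affine dependence. Then every `c i * a i`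
  -- is nonnegative although they sum to zero. A negative `c i` would make its term strictly
  -- positive, so all `c i` are nonnegative with sum zero.
  obtain ⟨f, ⟨w, b, rfl⟩, hf⟩ := h fun i => 0 ≤ c i
  let a : ι → ℝ := fun i => (∑ j : Fin d, w j.rev * bit ((φ i).reverse.getD j false)) + b
  have ha : ∀ i, 0 ≤ a i ↔ 0 ≤ c i := fun i => by
    simpa [linThreshold, a] using hf i
  have hzero : ∑ i, c i * a i = 0 := by
    simp only [a, mul_add, sum_add_distrib, ← sum_mul, hsum, zero_mul, add_zero, mul_sum]
    rw [sum_comm]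
    refine sum_eq_zero fun j _ => ?_
    have := hcomp (some j)
    simp only [v, Option.elim] at this
    calc _ = w j.rev * ∑ i, c i * bit ((φ i).reverse.getD j false) := by
          rw [mul_sum]; exact sum_congr rfl fun i _ => by ring
      _ = 0 := by rw [this, mul_zero]
  have hnonneg : ∀ i ∈ univ, 0 ≤ c i * a i := fun i _ => by
    rcases le_or_gt 0 (c i) with hci | hci
    · exact mul_nonneg hci ((ha i).2 hci)
    · exact mul_nonneg_of_nonpos_of_nonpos hci.le (not_le.1 fun h => hci.not_ge ((ha i).1 h)).le
  have hall := (sum_eq_zero_iff_of_nonneg hnonneg).1 hzero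
  have hcnonneg : ∀ i ∈ univ, 0 ≤ c i := fun i hi => by
    by_contra! hci
    have hai : a i < 0 := not_le.1 fun h => hci.not_ge ((ha i).1 h)
    exact (mul_pos_of_neg_of_neg hci hai).ne' (hall i hi)
  exact hi₀ ((sum_eq_zero_iff_of_nonneg hcnonneg).1 hsum i₀ (mem_univ _))

/-- The Sauer-Shelah bound for linear thresholds. -/
theorem ncard_image_linClass_le {α : Type*} [Fintype α] (φ : α → Str) (d : ℕ) :
    ((fun (f : Generator) (a : α) => f (φ a)) '' linClass d).ncard ≤
      ∑ k ∈ Iic (d + 1), (Fintype.card α).choose k := by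
  classical
  set R := (fun (f : Generator) (a : α) => f (φ a)) '' linClass d
  have hR : R.Finite := Set.toFinite _
  let toSet : (α → Bool) → Finset α := fun r => univ.filter fun a => r a = true
  have hinj : Function.Injective toSet := fun r s hrs => by
    funext a
    have := congrArg (a ∈ ·) hrs
    simpa [toSet, ← Bool.eq_iff_iff] using this
  let 𝒜 : Finset (Finset α) := hR.toFinset.image toSet
  have hdim : 𝒜.vcDim ≤ d + 1 := by
    refine Finset.sup_le fun s hs => ?_
    rw [mem_shatterer] at hs
    rw [← Fintype.card_coe]
    refine card_le_of_forall_exists_linClass (fun i : s => φ i) d fun P => ?_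
    obtain ⟨u, hu, hsu⟩ := hs (t := s.filter fun a => ∃ h : a ∈ s, P ⟨a, h⟩) (filter_subset _ _)
    obtain ⟨r, hr, rfl⟩ := mem_image.1 hu
    obtain ⟨f, hf, rfl⟩ := hR.mem_toFinset.1 hr
    refine ⟨f, hf, fun i => ?_⟩
    have := congrArg (i.1 ∈ ·) hsu
    simpa [toSet] using this
  calc R.ncard = 𝒜.card := by
        rw [card_image_of_injective _ hinj, Set.ncard_eq_toFinset_card _ hR]
    _ ≤ 𝒜.shatterer.card := card_le_card_shatterer _
    _ ≤ ∑ k ∈ Iic 𝒜.vcDim, (Fintype.card α).choose k := card_shatterer_le_sum_vcDim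
    _ ≤ _ := sum_le_sum_of_subset (Iic_subset_Iic.2 hdim)

/-- With `q = k / n ≤ 1`, weighting the terms by `q ^ i ≥ q ^ k` turns the sum into part of `(1 + q)
^ n ≤ exp k`. -/
theorem sum_choose_le_exp_mul_div_pow {n k : ℕ} (hk : 1 ≤ k) (hkn : k ≤ n) :
    ((∑ i ∈ Iic k, n.choose i : ℕ) : ℝ) ≤ (Real.exp 1 * n / k) ^ k := by
  have hk0 : (0 : ℝ) < k := by exact_mod_cast hk
  have hn0 : (0 : ℝ) < n := by exact_mod_cast hk.trans hkn
  set q : ℝ := k / n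
  have hq0 : 0 < q := div_pos hk0 hn0
  have hq1 : q ≤ 1 := (div_le_one hn0).2 (by exact_mod_cast hkn)
  have key : q ^ k * ((∑ i ∈ Iic k, n.choose i : ℕ) : ℝ) ≤ Real.exp k := by
    calc q ^ k * ((∑ i ∈ Iic k, n.choose i : ℕ) : ℝ)
        = ∑ i ∈ Iic k, q ^ k * (n.choose i : ℝ) := by push_cast; rw [mul_sum]
      _ ≤ ∑ i ∈ Iic k, q ^ i * (n.choose i : ℝ) := sum_le_sum fun i hi =>
          mul_le_mul_of_nonneg_right (pow_le_pow_of_le_one hq0.le hq1 (mem_Iic.1 hi)) (by positivity)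
      _ ≤ ∑ i ∈ range (n + 1), q ^ i * (n.choose i : ℝ) :=
          sum_le_sum_of_subset_of_nonneg
            (fun i hi => mem_range.2 (by have := mem_Iic.1 hi; omega)) fun i _ _ => by positivity
      _ = (q + 1) ^ n := by simp [add_pow]
      _ ≤ Real.exp q ^ n := by gcongr; exact Real.add_one_le_exp q
      _ = Real.exp k := by
          rw [← Real.exp_nat_mul]; congr 1; simp only [q]; field_simp
  have hE : (Real.exp 1 * n / k) ^ k = Real.exp k / q ^ k := by
    rw [← mul_one (k : ℝ), Real.exp_nat_mul, ← div_pow, mul_one]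
    congr 1; simp only [q]; field_simp
  rw [hE, le_div_iff₀ (pow_pos hq0 k), mul_comm]
  exact key

theorem ncard_image_linClass_le_pow {α : Type*} [Fintype α] (φ : α → Str) (d n : ℕ)
    (hα : Fintype.card α ≤ n) (hn : d + 1 ≤ n) :
    (((fun (f : Generator) (a : α) => f (φ a)) '' linClass d).ncard : ℝ) ≤
      (Real.exp 1 * n / (d + 1)) ^ (d + 1) := by
  calc _ ≤ ((∑ k ∈ Iic (d + 1), n.choose k : ℕ) : ℝ) := by
        exact_mod_cast (ncard_image_linClass_le φ d).trans
          (sum_le_sum fun k _ => Nat.choose_le_choose k hα)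
    _ ≤ _ := by simpa using sum_choose_le_exp_mul_div_pow (Nat.le_add_left 1 d) hn

theorem ncard_restrictToLength_linClass_le {d : ℕ} (hd : 1 ≤ d) :
    ((restrictToLength (linClass d) d).ncard : ℝ) ≤ (2 * Real.exp 1 * 2 ^ d) ^ (d + 1) := by
  refine (ncard_image_linClass_le_pow (α := List.Vector Bool d) (fun x => x.toList) d (2 ^ d)
    (by simp) Nat.lt_two_pow_self).trans ?_
  gcongr
  rw [div_le_iff₀ (by positivity)]
  push_cast
  have : (1 : ℝ) ≤ d := by exact_mod_cast hd
  have : 0 < Real.exp 1 * 2 ^ d := by positivity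
  nlinarith

theorem ncard_restrictToLength_linClass_le_two_pow {d : ℕ} (hd : 1 ≤ d) :
    (restrictToLength (linClass d) d).ncard ≤ 2 ^ (8 * d ^ 2) := by
  have h := ncard_restrictToLength_linClass_le hd
  have he : 2 * Real.exp 1 ≤ 2 ^ 3 := by linarith [Real.exp_one_lt_d9]
  have : ((restrictToLength (linClass d) d).ncard : ℝ) ≤ 2 ^ (8 * d ^ 2) := by
    calc _ ≤ (2 * Real.exp 1 * 2 ^ d) ^ (d + 1) := h
      _ ≤ (2 ^ 3 * 2 ^ d) ^ (d + 1) := by gcongr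
      _ = 2 ^ ((3 + d) * (d + 1)) := by rw [← pow_add, ← pow_mul]
      -- The exponent `d ^ 2 + 4 * d + 3` is at most `8 * d ^ 2`, with equality at `d = 1`.
      _ ≤ _ := pow_le_pow_right₀ one_le_two (by nlinarith)
  exact_mod_cast this

end VCDimension

/-! ### The `ε`-net theorem by double sampling -/

section EpsilonNet

open Finset

open scoped ENNReal

variable {X : Type*} {m : ℕ}

open Classical in
/-- A Chernoff bound for the lower tail of the number of sample points in `B`. -/
theorem measureReal_card_filter_lt_le [MeasurableSpace X] [DiscreteMeasurableSpace X] [Countable X] (D : Measure X)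
    [IsProbabilityMeasure D] (B : Set X) (k : ℕ) :
    (Measure.pi fun _ : Fin m => D).real {y | #{i | y i ∈ B} < k} ≤
      2 ^ k * (1 - D.real B / 2) ^ m := by
  -- Each hit of `B` halves the product of the `g (y i)`, so few hits mean a large product, and
  -- Markov's inequality applies.
  let g : X → ℝ := fun x => 1 - B.indicator (fun _ => 1 / 2) x
  have hg : ∀ x, g x = if x ∈ B then 1 / 2 else 1 := fun x => by
    by_cases hx : x ∈ B <;> simp [g, hx]; norm_num
  have hgint : ∫ x, g x ∂D = 1 - D.real B / 2 := by
    have hB : MeasurableSet B := .of_discrete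
    rw [integral_sub (integrable_const _) ((integrable_const _).indicator hB),
      integral_indicator hB]
    simp
    ring
  have hprod : ∀ y : Fin m → X, ∏ i, g (y i) = (1 / 2) ^ #{i | y i ∈ B} := fun y => by
    simp [hg, prod_ite]
  have hmarkov := mul_meas_ge_le_integral_of_nonneg
    (μ := Measure.pi fun _ : Fin m => D) (f := fun y => ∏ i, g (y i))
    (.of_forall fun y => by simp only [hprod]; positivity)
    (Integrable.of_bound (C := 1) (Measurable.of_discrete.aestronglyMeasurable)
      (.of_forall fun y => by
        simp only [hprod]
        rw [Real.norm_of_nonneg (by positivity)]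
        exact pow_le_one₀ (by norm_num) (by norm_num))) ((1 / 2) ^ k)
  rw [integral_fintype_prod_eq_prod (fun _ => g), prod_const, hgint] at hmarkov
  simp only [card_univ, Fintype.card_fin] at hmarkov
  calc _ ≤ (Measure.pi fun _ : Fin m => D).real {y | (1 / 2) ^ k ≤ ∏ i, g (y i)} := by
        refine measureReal_mono fun y hy => ?_
        simp only [Set.mem_ofPred_eq, hprod] at hy ⊢
        exact pow_le_pow_of_le_one (by norm_num) (by norm_num) hy.le
    _ = 2 ^ k * ((1 / 2) ^ k * (Measure.pi fun _ : Fin m => D).real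
          {y | (1 / 2) ^ k ≤ ∏ i, g (y i)}) := by
        rw [← mul_assoc, ← mul_pow]; norm_num
    _ ≤ _ := by gcongr

/-- Exchange the two entries of `z i` for all `i` with `σ i = true`. -/
def swapPairs (σ : Fin m → Bool) (z : Fin m → X × X) : Fin m → X × X :=
  fun i => if σ i then (z i).swap else z i

theorem measurePreserving_swapPairs [MeasurableSpace X] (D : Measure X) [IsProbabilityMeasure D] (σ : Fin m → Bool) :
    MeasurePreserving (swapPairs σ) (Measure.pi fun _ : Fin m => D.prod D)
      (Measure.pi fun _ : Fin m => D.prod D) := by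
  refine measurePreserving_pi (f := fun i p => if σ i then Prod.swap p else p) _ _ fun i => ?_
  by_cases h : σ i
  · simpa [h] using Measure.measurePreserving_swap
  · simpa [h] using! MeasurePreserving.id (D.prod D)

open Classical in
/-- Few exchanges put no point of `B` into the first half and `k` of them into the second. -/
theorem card_swapPairs_mul_le (B : Set X) (k : ℕ) (z : Fin m → X × X) :
    #{σ : Fin m → Bool | (∀ i, (swapPairs σ z i).1 ∉ B) ∧ k ≤ #{i | (swapPairs σ z i).2 ∈ B}} *
      2 ^ k ≤ 2 ^ m := by
  set E : Finset (Fin m → Bool) :=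
    {σ | (∀ i, (swapPairs σ z i).1 ∉ B) ∧ k ≤ #{i | (swapPairs σ z i).2 ∈ B}}
  rcases E.eq_empty_or_nonempty with hE | ⟨τ, hτ⟩
  · simp [hE]
  obtain ⟨-, -, hk⟩ := mem_filter.1 hτ
  set I : Finset (Fin m) := {i | (swapPairs τ z i).2 ∈ B}
  -- Disagreeing with `τ` at `i ∈ I` would move a point of `B` into the first half. So only the
  -- coordinates outside `I` are free.
  have hagree : ∀ σ ∈ E, ∀ i ∈ I, σ i = τ i := fun σ hσ i hi => by
    obtain ⟨-, hσ, -⟩ := mem_filter.1 hσ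
    have h1 := hσ i
    have h2 := (mem_filter.1 hi).2
    by_contra hne
    cases h : σ i <;> cases h' : τ i <;> simp_all [swapPairs]
  have hcard : #E ≤ Fintype.card ({i // i ∉ I} → Bool) := by
    rw [← card_univ]
    refine card_le_card_of_injOn (fun σ i => σ i) (fun _ _ => mem_univ _) fun σ hσ ρ hρ h => ?_
    funext i
    by_cases hi : i ∈ I
    · rw [hagree σ hσ i hi, hagree ρ hρ i hi]
    · exact congrFun h ⟨i, hi⟩
  have hI : #I ≤ m := by simpa using card_le_univ I
  calc #E * 2 ^ k ≤ 2 ^ (m - #I) * 2 ^ #I := by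
        refine Nat.mul_le_mul ?_ (Nat.pow_le_pow_right two_pos hk)
        simpa [Fintype.card_subtype_compl] using hcard
    _ = 2 ^ m := by rw [← pow_add, Nat.sub_add_cancel hI]

open Classical in
-- Swaps keep the same at most `2 * m` points, so only the trace of `B` on them matters: a union
-- bound over at most `G` traces.
theorem card_swapPairs_exists_mul_le (𝓑 : Set (Set X)) (G k : ℕ)
    (hG : ∀ S : Finset X, #S ≤ 2 * m → ((fun B => B ∩ (S : Set X)) '' 𝓑).ncard ≤ G)
    (z : Fin m → X × X) :
    #{σ : Fin m → Bool | ∃ B ∈ 𝓑, (∀ i, (swapPairs σ z i).1 ∉ B) ∧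
      k ≤ #{i | (swapPairs σ z i).2 ∈ B}} * 2 ^ k ≤ G * 2 ^ m := by
  let S : Finset X := univ.image (fun i => (z i).1) ∪ univ.image (fun i => (z i).2)
  have hS : #S ≤ 2 * m := by
    refine (card_union_le _ _).trans ?_
    have h1 := card_image_le (s := (univ : Finset (Fin m))) (f := fun i => (z i).1)
    have h2 := card_image_le (s := (univ : Finset (Fin m))) (f := fun i => (z i).2)
    simp only [card_univ, Fintype.card_fin] at h1 h2
    omega
  have hmem : ∀ σ i, (swapPairs σ z i).1 ∈ S ∧ (swapPairs σ z i).2 ∈ S := fun σ i => by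
    cases h : σ i <;> simp [S, swapPairs, h]
  have hfin : ((fun B => B ∩ (S : Set X)) '' 𝓑).Finite :=
    (S.finite_toSet.finite_subsets).subset (by rintro _ ⟨B, -, rfl⟩; exact Set.inter_subset_right)
  have hsub : ({σ : Fin m → Bool | ∃ B ∈ 𝓑, (∀ i, (swapPairs σ z i).1 ∉ B) ∧
      k ≤ #{i | (swapPairs σ z i).2 ∈ B}} : Finset _) ⊆ hfin.toFinset.biUnion fun B =>
        {σ | (∀ i, (swapPairs σ z i).1 ∉ B) ∧ k ≤ #{i | (swapPairs σ z i).2 ∈ B}} := by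
    intro σ hσ
    obtain ⟨-, B, hB, h1, h2⟩ := mem_filter.1 hσ
    refine mem_biUnion.2 ⟨B ∩ S, hfin.mem_toFinset.2 ⟨B, hB, rfl⟩, ?_⟩
    simpa [hmem] using And.intro h1 h2
  calc _ ≤ (∑ B ∈ hfin.toFinset, #{σ : Fin m → Bool | (∀ i, (swapPairs σ z i).1 ∉ B) ∧
        k ≤ #{i | (swapPairs σ z i).2 ∈ B}}) * 2 ^ k := by
        gcongr
        exact (card_le_card hsub).trans card_biUnion_le
    _ ≤ ∑ _B ∈ hfin.toFinset, 2 ^ m := by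
        rw [sum_mul]; exact sum_le_sum fun B _ => card_swapPairs_mul_le B k z
    _ ≤ G * 2 ^ m := by
        rw [sum_const, smul_eq_mul, ← Set.ncard_eq_toFinset_card _ hfin]
        gcongr; exact hG S hS

/-- The union bound over a finite class. -/
theorem measureReal_exists_disjoint_le_of_finite [MeasurableSpace X]
    [DiscreteMeasurableSpace X] (D : Measure X) [IsProbabilityMeasure D]
    {𝓑 : Set (Set X)} (h𝓑 : 𝓑.Finite) (ε : ℝ) :
    (Measure.pi fun _ : Fin m => D).real {x | ∃ B ∈ 𝓑, ε < D.real B ∧ ∀ i, x i ∉ B} ≤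
      𝓑.ncard * Real.exp (-(ε * m)) := by
  classical
  set μ := Measure.pi fun _ : Fin m => D
  calc μ.real {x | ∃ B ∈ 𝓑, ε < D.real B ∧ ∀ i, x i ∉ B}
      ≤ μ.real (⋃ B ∈ h𝓑.toFinset, {x | ε < D.real B ∧ ∀ i, x i ∉ B}) :=
        measureReal_mono (fun x ⟨B, hB, hx⟩ => by
          simp only [Set.mem_iUnion]; exact ⟨B, h𝓑.mem_toFinset.2 hB, hx⟩) (measure_ne_top _ _)
    _ ≤ ∑ B ∈ h𝓑.toFinset, μ.real {x | ε < D.real B ∧ ∀ i, x i ∉ B} :=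
        measureReal_biUnion_finset_le _ _
    _ ≤ ∑ _B ∈ h𝓑.toFinset, Real.exp (-(ε * m)) := by
        refine sum_le_sum fun B _ => ?_
        by_cases hB : ε < D.real B
        · have hset : {x : Fin m → X | ε < D.real B ∧ ∀ i, x i ∉ B} =
              Set.univ.pi fun _ => Bᶜ := by ext x; simp [hB]
          have hcompl : D.real Bᶜ = 1 - D.real B := probReal_compl_eq_one_sub .of_discrete
          rw [hset, Measure.real, Measure.pi_pi, prod_const, ENNReal.toReal_pow]
          change D.real Bᶜ ^ _ ≤ _
          rw [card_univ, Fintype.card_fin, show -(ε * m) = m * (-ε) by ring, Real.exp_nat_mul]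
          gcongr
          linarith [Real.add_one_le_exp (-ε)]
        · simp [hB]; positivity
    _ = _ := by rw [sum_const, nsmul_eq_mul, Set.ncard_eq_toFinset_card _ h𝓑]

variable [MeasurableSpace X] [DiscreteMeasurableSpace X] [Countable X]

open Classical in
-- Symmetrization: swaps preserve the measure, so the probability is the mean, over `z`, of the
-- fraction of swaps that land in the event. That fraction is bounded for each fixed `z`.
theorem measure_pi_prod_le (D : Measure X) [IsProbabilityMeasure D] (𝓑 : Set (Set X)) (G k : ℕ)
    (hG : ∀ S : Finset X, #S ≤ 2 * m → ((fun B => B ∩ (S : Set X)) '' 𝓑).ncard ≤ G) :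
    (Measure.pi fun _ : Fin m => D.prod D)
      {z | ∃ B ∈ 𝓑, (∀ i, (z i).1 ∉ B) ∧ k ≤ #{i | (z i).2 ∈ B}} * 2 ^ k ≤ G := by
  set ν := Measure.pi fun _ : Fin m => D.prod D
  set Z : Set (Fin m → X × X) := {z | ∃ B ∈ 𝓑, (∀ i, (z i).1 ∉ B) ∧ k ≤ #{i | (z i).2 ∈ B}}
  have hZ : ∀ s : Set (Fin m → X × X), MeasurableSet s := fun s => s.to_countable.measurableSet
  have h1 : (2 ^ m : ℝ≥0∞) * ν Z = ∫⁻ z, #{σ : Fin m → Bool | swapPairs σ z ∈ Z} ∂ν := by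
    calc (2 ^ m : ℝ≥0∞) * ν Z = ∑ σ : Fin m → Bool, ν (swapPairs σ ⁻¹' Z) := by
          simp [fun σ => (measurePreserving_swapPairs D σ).measure_preimage (hZ Z).nullMeasurableSet,
            ν]
      _ = ∑ σ : Fin m → Bool, ∫⁻ z, (swapPairs σ ⁻¹' Z).indicator 1 z ∂ν := by
          simp [lintegral_indicator_one (hZ _)]
      _ = ∫⁻ z, ∑ σ : Fin m → Bool, (swapPairs σ ⁻¹' Z).indicator 1 z ∂ν :=
          (lintegral_finsetSum _ fun σ _ => measurable_one.indicator (hZ _)).symm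
      _ = _ := by
          refine lintegral_congr fun z => ?_
          simp [Set.indicator_apply, sum_boole]
  have h2 : (2 ^ m : ℝ≥0∞) * (ν Z * 2 ^ k) ≤ 2 ^ m * G := by
    calc (2 ^ m : ℝ≥0∞) * (ν Z * 2 ^ k)
        = ∫⁻ z, #{σ : Fin m → Bool | swapPairs σ z ∈ Z} * 2 ^ k ∂ν := by
          rw [← mul_assoc, h1, lintegral_mul_const' _ _ (by simp)]
      _ ≤ ∫⁻ _, (G * 2 ^ m : ℝ≥0∞) ∂ν := lintegral_mono fun z => by
          have := card_swapPairs_exists_mul_le 𝓑 G k hG z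
          simp only [Z, Set.mem_ofPred_eq]
          exact_mod_cast this
      _ = 2 ^ m * G := by simp [ν, mul_comm]
  exact (ENNReal.mul_le_mul_iff_right (by simp) (by simp)).1 h2

open Classical in
/-- The `ε`-net theorem: with high probability a sample meets all the sets of measure more than
`ε` in a class with few traces on finite sets. -/
theorem measureReal_exists_disjoint_le (D : Measure X) [IsProbabilityMeasure D] (𝓑 : Set (Set X))
    (G k : ℕ) {ε : ℝ} (hε : 0 < ε) (hm : 8 ≤ ε * m) (hk : (k : ℝ) ≤ ε * m / 4 + 1)
    (hG : ∀ S : Finset X, #S ≤ 2 * m → ((fun B => B ∩ (S : Set X)) '' 𝓑).ncard ≤ G) :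
    (Measure.pi fun _ : Fin m => D).real {x | ∃ B ∈ 𝓑, ε < D.real B ∧ ∀ i, x i ∉ B} ≤
      2 * G / 2 ^ k := by
  set μ := Measure.pi fun _ : Fin m => D
  set A : Set (Fin m → X) := {x | ∃ B ∈ 𝓑, ε < D.real B ∧ ∀ i, x i ∉ B}
  set Z : Set ((Fin m → X) × (Fin m → X)) :=
    {z | ∃ B ∈ 𝓑, (∀ i, z.1 i ∉ B) ∧ k ≤ #{i | z.2 i ∈ B}}
  have hmeas : ∀ s : Set (Fin m → X), MeasurableSet s := fun s => s.to_countable.measurableSet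
  have hZ : MeasurableSet Z := Z.to_countable.measurableSet
  -- By `hk` and `hm`, the exponent `k - ε * m / 2` is at most `1 - ε * m / 4 ≤ -1`.
  have htail : ∀ B : Set X, ε < D.real B → μ.real {y | #{i | y i ∈ B} < k} ≤ 1 / 2 := by
    intro B hB
    have hB1 : D.real B ≤ 1 := measureReal_le_one
    have h2e : (2 : ℝ) ≤ Real.exp 1 := by linarith [Real.add_one_le_exp 1]
    calc _ ≤ 2 ^ k * (1 - D.real B / 2) ^ m := measureReal_card_filter_lt_le D B k
      _ ≤ Real.exp 1 ^ k * Real.exp (-(ε / 2)) ^ m := by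
          gcongr
          · exact pow_nonneg (by linarith) m
          · linarith
          · linarith [Real.add_one_le_exp (-(ε / 2))]
      _ = Real.exp (k - ε * m / 2) := by
          rw [← Real.exp_nat_mul, ← Real.exp_nat_mul, ← Real.exp_add]; congr 1; ring
      _ ≤ Real.exp (-1) := by gcongr; linarith
      _ ≤ 1 / 2 := by
          rw [Real.exp_neg, ← one_div]
          exact one_div_le_one_div_of_le two_pos h2e
  -- An independent ghost sample hits the missed set at least `k` times with probability at least
  -- one half, so `A` is at most twice as likely as `Z`.
  have hfiber : ∀ x ∈ A, (1 / 2 : ℝ≥0∞) ≤ μ (Prod.mk x ⁻¹' Z) := by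
    rintro x ⟨B, hB, hεB, hx⟩
    have hcompl := probReal_compl_eq_one_sub (μ := μ) (hmeas {y | #{i | y i ∈ B} < k})
    have hhalf : 1 / 2 ≤ μ.real {y | #{i | y i ∈ B} < k}ᶜ := by linarith [htail B hεB]
    calc (1 / 2 : ℝ≥0∞) = ENNReal.ofReal (1 / 2) := by
          rw [ENNReal.ofReal_div_of_pos two_pos]; simp
      _ ≤ ENNReal.ofReal (μ.real {y | #{i | y i ∈ B} < k}ᶜ) := ENNReal.ofReal_le_ofReal hhalf
      _ = μ {y | #{i | y i ∈ B} < k}ᶜ := ofReal_measureReal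
      _ ≤ μ (Prod.mk x ⁻¹' Z) := measure_mono fun y (hy : ¬ #{i | y i ∈ B} < k) =>
          show ∃ B ∈ 𝓑, (∀ i, x i ∉ B) ∧ k ≤ #{i | y i ∈ B} from ⟨B, hB, hx, not_lt.1 hy⟩
  have hsymm : μ A * (1 / 2) ≤ (μ.prod μ) Z := by
    rw [Measure.prod_apply hZ, mul_comm, ← lintegral_indicator_const (hmeas A)]
    refine lintegral_mono fun x => ?_
    by_cases hx : x ∈ A
    · simpa [hx] using hfiber x hx
    · simp [hx]
  have hpairs : (μ.prod μ) Z * 2 ^ k ≤ G := by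
    rw [← (measurePreserving_arrowProdEquivProdArrow X X (Fin m) (fun _ => D)
      (fun _ => D)).measure_preimage hZ.nullMeasurableSet]
    exact measure_pi_prod_le D 𝓑 G k hG
  have hfinal : μ A * (1 / 2) * 2 ^ k ≤ G := (mul_le_mul_left hsymm _).trans hpairs
  have hreal := ENNReal.toReal_mono (by simp) hfinal
  simp only [ENNReal.toReal_mul, ENNReal.toReal_pow, ENNReal.toReal_div, ENNReal.toReal_one,
    ENNReal.toReal_ofNat, ENNReal.toReal_natCast] at hreal
  rw [le_div_iff₀ (by positivity)]
  simp only [Measure.real]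
  linarith

end EpsilonNet

/-! ### Growth of the error sets -/

section Growth

theorem ncard_image_le_ncard_image {α β γ : Type*} [Nonempty α] (r : α → β) (s : α → γ) {F : Set α}
    (hr : (r '' F).Finite) (h : ∀ g ∈ F, ∀ g' ∈ F, r g = r g' → s g = s g') :
    (s '' F).ncard ≤ (r '' F).ncard := by
  refine Set.ncard_le_ncard_of_injOn (fun c => r (Function.invFunOn s F c))
    (fun c hc => ⟨_, Function.invFunOn_mem hc, rfl⟩) (fun c hc c' hc' hcc' => ?_) hr
  rw [← Function.invFunOn_eq hc, ← Function.invFunOn_eq hc']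
  exact h _ (Function.invFunOn_mem hc) _ (Function.invFunOn_mem hc') hcc'

theorem finite_image_of_factors {α β γ : Type*} [Nonempty α] (r : α → β) (s : α → γ) {F : Set α}
    (hr : (r '' F).Finite) (h : ∀ g ∈ F, ∀ g' ∈ F, r g = r g' → s g = s g') :
    (s '' F).Finite :=
  Set.Finite.of_finite_image (f := fun c => r (Function.invFunOn s F c))
    (hr.subset (by rintro _ ⟨c, hc, rfl⟩; exact ⟨_, Function.invFunOn_mem hc, rfl⟩))
    fun c hc c' hc' hcc' => by
      rw [← Function.invFunOn_eq hc, ← Function.invFunOn_eq hc']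
      exact h _ (Function.invFunOn_mem hc) _ (Function.invFunOn_mem hc') hcc'

theorem cot_succ (f : Generator) (t : ℕ) (x : Str) :
    cot f (t + 1) x = cot f t x ++ [f (cot f t x)] :=
  Function.iterate_succ_apply' _ _ _

theorem exists_cot_eq_append (f : Generator) (t : ℕ) (x : Str) :
    ∃ u : Str, u.length = t ∧ cot f t x = x ++ u := by
  induction t with
  | zero => exact ⟨[], rfl, by simp [cot]⟩
  | succ t ih =>
    obtain ⟨u, hu, h⟩ := ih
    exact ⟨u ++ [f (x ++ u)], by simp [hu], by simp [cot_succ, h]⟩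

theorem take_length_sub_cot (f : Generator) (t : ℕ) (x : Str) :
    (cot f t x).take ((cot f t x).length - t) = x := by
  obtain ⟨u, rfl, h⟩ := exists_cot_eq_append f t x
  simp [h]

/-- Until the first disagreement both runs coincide, so `g` need only be queried along the chain of
`f`. -/
theorem cot_eq_iff (f g : Generator) (T : ℕ) (x : Str) :
    cot g T x = cot f T x ↔ ∀ t < T, g (cot f t x) = f (cot f t x) := by
  induction T with
  | zero => simp [cot]
  | succ T ih =>
    rw [Nat.forall_lt_succ_right, ← ih, cot_succ, cot_succ]
    constructor
    · intro h
      obtain ⟨h1, h2⟩ := List.append_inj' h rfl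
      exact ⟨h1, by simpa [h1] using h2⟩
    · rintro ⟨h1, h2⟩
      rw [h1, h2]

/-- The sets on which the final answers of the members of `F` differ from those of `f`. -/
def eteErrorSets (F : Set Generator) (f : Generator) (T : ℕ) : Set (Set Str) :=
  (fun g : Generator => {x | ete g T x ≠ ete f T x}) '' F

/-- The sets on which the Chains-of-Thought of the members of `F` differ from those of `f`. -/
def cotErrorSets (F : Set Generator) (f : Generator) (T : ℕ) : Set (Set Str) :=
  (fun g : Generator => {x | cot g T x ≠ cot f T x}) '' F

/-- Only the last `d` tokens are read, and padding a short string with zeros on the left changes no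
value. Hence the class is finite. -/
theorem eq_of_mem_linClass {d : ℕ} {f g : Generator} (hf : f ∈ linClass d) (hg : g ∈ linClass d)
    (h : ∀ v : List.Vector Bool d, f v.toList = g v.toList) : f = g := by
  have hpad : ∀ f ∈ linClass d, ∀ x : Str,
      f (List.ofFn fun i : Fin d => x.reverse.getD i false).reverse = f x := by
    rintro _ ⟨w, b, rfl⟩ x
    simp only [linThreshold, List.reverse_reverse]
    congr! 5 with i
    simp
  funext x
  rw [← hpad f hf, ← hpad g hg]
  exact h ⟨_, by simp⟩

theorem finite_image_linClass {γ : Type*} (s : Generator → γ) (d : ℕ) :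
    (s '' linClass d).Finite :=
  finite_image_of_factors (fun (f : Generator) (v : List.Vector Bool d) => f v.toList) s
    (Set.toFinite _) fun g hg g' hg' h => by rw [eq_of_mem_linClass hg hg' (congrFun h)]

theorem ncard_image_linClass_le_two_pow {γ : Type*} (s : Generator → γ) {d : ℕ} (hd : 1 ≤ d) :
    (s '' linClass d).ncard ≤ 2 ^ (8 * d ^ 2) :=
  (ncard_image_le_ncard_image (fun (f : Generator) (v : List.Vector Bool d) => f v.toList) s
    (Set.toFinite _) fun g hg g' hg' h => by rw [eq_of_mem_linClass hg hg' (congrFun h)]).trans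
    (ncard_restrictToLength_linClass_le_two_pow hd)

/-- The traces of `𝓑` on finite sets are as few as the Sauer-Shelah bound for dimension `d + 1`
allows when every point of the set counts `N` times. -/
def HasGrowth (𝓑 : Set (Set Str)) (d N : ℕ) : Prop :=
  ∀ (S : Finset Str) (n : ℕ), S.card * N ≤ n → d + 1 ≤ n →
    (((fun B => B ∩ (S : Set Str)) '' 𝓑).ncard : ℝ) ≤ (Real.exp 1 * n / (d + 1)) ^ (d + 1)

theorem hasGrowth_cotErrorSets (f : Generator) (d T : ℕ) :
    HasGrowth (cotErrorSets (linClass d) f T) d T := by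
  intro S n hS hn
  let φ : S × Fin T → Str := fun a => cot f a.2 a.1
  rw [cotErrorSets, Set.image_image]
  refine le_trans ?_ (ncard_image_linClass_le_pow φ d n (by simpa using hS) hn)
  refine Nat.cast_le.2 (ncard_image_le_ncard_image _ _ (Set.toFinite _) fun g _ g' _ h => ?_)
  ext x
  simp only [Set.mem_inter_iff, Set.mem_ofPred_eq, and_congr_left_iff, ne_eq, not_iff_not,
    cot_eq_iff]
  refine fun hx => forall₂_congr fun t ht => ?_
  rw [show g (cot f t x) = g' (cot f t x) from congrFun h (⟨x, hx⟩, ⟨t, ht⟩)]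

/-- The final answer of `g` depends on its own chain, which may leave that of `f`. Querying `x`
followed by every string of length below `T` covers all possible chains; the index set counts these
with repetitions. -/
theorem hasGrowth_eteErrorSets (f : Generator) (d T : ℕ) :
    HasGrowth (eteErrorSets (linClass d) f T) d (T * 2 ^ T) := by
  intro S n hS hn
  let φ : S × Fin T × (Fin T → Bool) → Str := fun a => a.1 ++ (List.ofFn a.2.2).take a.2.1
  rw [eteErrorSets, Set.image_image]
  refine le_trans ?_ (ncard_image_linClass_le_pow φ d n (by simpa using hS) hn)
  refine Nat.cast_le.2 (ncard_image_le_ncard_image _ _ (Set.toFinite _) fun g _ g' _ h => ?_)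
  have key : ∀ x ∈ S, cot g T x = cot g' T x := fun x hx => by
    refine (cot_eq_iff g' g T x).2 fun t ht => ?_
    obtain ⟨u, rfl, hu⟩ := exists_cot_eq_append g' t x
    have hofFn : (List.ofFn fun i : Fin T => u.getD i false).take u.length = u := by
      apply List.ext_getElem
      · simp [ht.le]
      · intro i h1 h2
        simp [h2]
    have := congrFun h (⟨x, hx⟩, ⟨u.length, ht⟩, fun i => u.getD i false)
    simpa only [φ, hofFn, hu] using this
  ext x
  simp only [Set.mem_inter_iff, Set.mem_ofPred_eq, and_congr_left_iff, ete]
  intro hx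
  rw [key x hx]

end Growth

/-! ### Solving for the sample size -/

section SampleSize

/-- A sample size that suffices for a class with at most `2 ^ (8 * d ^ 2)` members whose traces
are bounded as in `HasGrowth`. -/
noncomputable def sampleSize (d N : ℕ) (ε δ : ℝ) : ℕ :=
  ⌈200 * ((min ((d : ℝ) ^ 2) (d * Real.log (2 * N) * Real.log (2 / ε)) + Real.log (1 / δ)) / ε)⌉₊

variable {d N : ℕ} {ε δ : ℝ}

theorem log_two_le_log_two_mul (hN : 1 ≤ N) : Real.log 2 ≤ Real.log (2 * N) := by
  have : (1 : ℝ) ≤ N := by exact_mod_cast hN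
  exact Real.log_le_log two_pos (by linarith)

theorem log_two_le_log_two_div (hε : 0 < ε) (hε1 : ε < 1) : Real.log 2 ≤ Real.log (2 / ε) :=
  Real.log_le_log two_pos ((le_div_iff₀ hε).2 (by linarith))

theorem le_mul_log_mul_log (hd : 1 ≤ d) (hN : 1 ≤ N) (hε : 0 < ε) (hε1 : ε < 1) :
    (d : ℝ) * (Real.log 2 * Real.log 2) ≤ d * Real.log (2 * N) * Real.log (2 / ε) := by
  have := log_two_le_log_two_mul hN
  have := log_two_le_log_two_div hε hε1
  have : 0 < Real.log 2 := Real.log_pos one_lt_two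
  rw [mul_assoc]
  gcongr
  linarith

theorem sampleSize_le (hd : 1 ≤ d) (hN : 1 ≤ N) (hε : 0 < ε) (hε1 : ε < 1) (hδ : 0 < δ)
    (hδ1 : δ < 1) : (sampleSize d N ε δ : ℝ) ≤
      400 * ((min ((d : ℝ) ^ 2) (d * Real.log (2 * N) * Real.log (2 / ε)) + Real.log (1 / δ)) / ε)
      := by
  have hd' : (1 : ℝ) ≤ d := by exact_mod_cast hd
  have h0 : 0 ≤ Real.log (1 / δ) := Real.log_nonneg ((le_div_iff₀ hδ).2 (by linarith))
  have h2 := Real.log_two_gt_d9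
  have h1 := le_mul_log_mul_log hd hN hε hε1
  -- This lower bound lets the rounding error `1` of the ceiling be absorbed by doubling the
  -- constant.
  have hmin : 1 / 200 ≤ min ((d : ℝ) ^ 2) (d * Real.log (2 * N) * Real.log (2 / ε)) :=
    le_min (by nlinarith) (by nlinarith)
  set y := (min ((d : ℝ) ^ 2) (d * Real.log (2 * N) * Real.log (2 / ε)) + Real.log (1 / δ)) / ε
  have hy : 1 / 200 ≤ y := (le_div_iff₀ hε).2 (by nlinarith)
  have := (Nat.ceil_lt_add_one (a := 200 * y) (by positivity)).le
  rw [sampleSize]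
  linarith

theorem le_mul_sampleSize (hε : 0 < ε) :
    200 * (min ((d : ℝ) ^ 2) (d * Real.log (2 * N) * Real.log (2 / ε)) + Real.log (1 / δ)) ≤
      ε * sampleSize d N ε δ := by
  have := Nat.le_ceil
    (200 * ((min ((d : ℝ) ^ 2) (d * Real.log (2 * N) * Real.log (2 / ε)) + Real.log (1 / δ)) / ε))
  rw [← mul_div_assoc, div_le_iff₀ hε] at this
  rw [mul_comm ε]
  rwa [sampleSize, ← mul_div_assoc]

/-- The growth bound is polynomial in `m`, while `2 ^ k` is exponential in `ε * m`. The inequality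
`log u ≤ u - 1` trades `log m` for a small fraction of `ε * m`. -/
theorem two_mul_growth_div_two_pow_le {m k : ℕ} (hd : 1 ≤ d) (hN : 1 ≤ N) (hε : 0 < ε)
    (hε1 : ε < 1) (hδ : 0 < δ) (hδ1 : δ < 1)
    (hm : 200 * (d * Real.log (2 * N) * Real.log (2 / ε) + Real.log (1 / δ)) ≤ ε * m)
    (hk : ε * m / 4 ≤ k) :
    2 * (Real.exp 1 * (2 * m * N : ℕ) / (d + 1)) ^ (d + 1) / 2 ^ k ≤ δ := by
  have hd' : (1 : ℝ) ≤ d := by exact_mod_cast hd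
  have hN0 : (0 : ℝ) < N := by exact_mod_cast hN
  have ha := log_two_le_log_two_mul hN
  have hb := log_two_le_log_two_div hε hε1
  have h1 := le_mul_log_mul_log hd hN hε hε1
  have h0 : 0 ≤ Real.log (1 / δ) := Real.log_nonneg ((le_div_iff₀ hδ).2 (by linarith))
  have hl := Real.log_two_gt_d9
  have hl' := Real.log_two_lt_d9
  set a := Real.log (2 * N)
  set b := Real.log (2 / ε)
  have hεm : 0 < ε * m := by nlinarith
  have hm0 : (0 : ℝ) < m := pos_of_mul_pos_right hεm hε.le
  set x := Real.exp 1 * (2 * m * N : ℕ) / (d + 1)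
  have hx0 : 0 < x := by simp only [x]; push_cast; positivity
  -- The first factor is the `u` above, scaled so that it costs only `ε * m / 32` in total; the
  -- factor `exp 1` cancels the `-1`.
  have hxe : x = ε * m / (32 * (d + 1)) * (2 * N * (2 / ε) * (Real.exp 1 * 2 ^ 4)) := by
    simp only [x]; push_cast; field_simp; ring
  have hlog : Real.log x ≤ ε * m / (32 * (d + 1)) + (a + b + 4 * Real.log 2) := by
    have hu : 0 < ε * m / (32 * (d + 1)) := by positivity
    have := Real.log_le_sub_one_of_pos hu
    rw [hxe, Real.log_mul hu.ne' (by positivity), Real.log_mul (by positivity) (by positivity),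
      Real.log_mul (by positivity : (2 * N : ℝ) ≠ 0) (by positivity), Real.log_mul (Real.exp_pos 1).ne' (by positivity),
      Real.log_exp, Real.log_pow]
    push_cast
    linarith
  have hlog' : (d + 1) * Real.log x ≤ ε * m / 32 + 2 * d * (a + b + 4 * Real.log 2) := by
    calc (d + 1) * Real.log x
        ≤ (d + 1) * (ε * m / (32 * (d + 1)) + (a + b + 4 * Real.log 2)) := by gcongr
      _ = ε * m / 32 + (d + 1) * (a + b + 4 * Real.log 2) := by field_simp
      _ ≤ _ := by gcongr <;> linarith
  -- Since `a` and `b` are at least `log 2`, the left side is at most `(6 / log 2) * (a * b)`, and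
  -- `6 / log 2 < 9`.
  have hab : a + b + 4 * Real.log 2 ≤ 9 * (a * b) := by
    nlinarith [mul_nonneg (sub_nonneg.2 ha) (sub_nonneg.2 hb)]
  have hdab : 2 * d * (a + b + 4 * Real.log 2) ≤ 18 * (d * a * b) := by
    calc 2 * d * (a + b + 4 * Real.log 2) ≤ 2 * d * (9 * (a * b)) := by gcongr
      _ = _ := by ring
  have hk' : ε * m / 4 * 0.69 ≤ k * Real.log 2 := by gcongr; linarith
  have hx : x ^ (d + 1) = Real.exp ((d + 1) * Real.log x) := by
    rw [show ((d : ℝ) + 1) = ((d + 1 : ℕ) : ℝ) by push_cast; ring, Real.exp_nat_mul,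
      Real.exp_log hx0]
  have h2k : (2 : ℝ) ^ k = Real.exp (k * Real.log 2) := by
    rw [Real.exp_nat_mul, Real.exp_log two_pos]
  calc 2 * x ^ (d + 1) / 2 ^ k
      = Real.exp (Real.log 2 + (d + 1) * Real.log x - k * Real.log 2) := by
        rw [Real.exp_sub, Real.exp_add, Real.exp_log two_pos, ← hx, ← h2k]
    _ ≤ Real.exp (-Real.log (1 / δ)) := by
        gcongr
        nlinarith
    _ = δ := by rw [one_div, Real.log_inv, neg_neg, Real.exp_log hδ]

theorem two_pow_mul_exp_neg_le {m : ℕ} (hδ : 0 < δ) (hδ1 : δ < 1)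
    (hm : 200 * ((d : ℝ) ^ 2 + Real.log (1 / δ)) ≤ ε * m) :
    2 ^ (8 * d ^ 2) * Real.exp (-(ε * m)) ≤ δ := by
  have h0 : 0 ≤ Real.log (1 / δ) := Real.log_nonneg ((le_div_iff₀ hδ).2 (by linarith))
  have hl' := Real.log_two_lt_d9
  have h2 : (2 : ℝ) ^ (8 * d ^ 2) = Real.exp ((8 * d ^ 2 : ℕ) * Real.log 2) := by
    rw [Real.exp_nat_mul, Real.exp_log two_pos]
  calc (2 : ℝ) ^ (8 * d ^ 2) * Real.exp (-(ε * m))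
      = Real.exp ((8 * d ^ 2 : ℕ) * Real.log 2 - ε * m) := by
        rw [h2, ← Real.exp_add, ← sub_eq_add_neg]
    _ ≤ Real.exp (-Real.log (1 / δ)) := by
        gcongr
        push_cast
        nlinarith [sq_nonneg (d : ℝ)]
    _ = δ := by rw [one_div, Real.log_inv, neg_neg, Real.exp_log hδ]

/-- A sample of size `sampleSize d N ε δ` meets all the sets of measure more than `ε`, except with
probability at most `δ`. -/
theorem measureReal_exists_disjoint_sampleSize_le (D : Measure Str) [IsProbabilityMeasure D]
    {𝓑 : Set (Set Str)} (hd : 1 ≤ d) (hN : 1 ≤ N) (hε : 0 < ε) (hε1 : ε < 1) (hδ : 0 < δ)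
    (hδ1 : δ < 1) (hfin : 𝓑.Finite) (hcard : 𝓑.ncard ≤ 2 ^ (8 * d ^ 2)) (hgr : HasGrowth 𝓑 d N) :
    (Measure.pi fun _ : Fin (sampleSize d N ε δ) => D).real
      {x | ∃ B ∈ 𝓑, ε < D.real B ∧ ∀ i, x i ∉ B} ≤ δ := by
  have hm := le_mul_sampleSize (d := d) (N := N) (δ := δ) hε
  set m := sampleSize d N ε δ
  -- The smaller term decides the method: the union bound for `d ^ 2`, the `ε`-net theorem
  -- otherwise.
  rcases le_total ((d : ℝ) ^ 2) (d * Real.log (2 * N) * Real.log (2 / ε)) with hle | hle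
  · rw [min_eq_left hle] at hm
    refine (measureReal_exists_disjoint_le_of_finite D hfin ε).trans
      (le_trans ?_ (two_pow_mul_exp_neg_le hδ hδ1 hm))
    gcongr
    exact_mod_cast hcard
  · rw [min_eq_right hle] at hm
    have hd' : (1 : ℝ) ≤ d := by exact_mod_cast hd
    have h0 : 0 ≤ Real.log (1 / δ) := Real.log_nonneg ((le_div_iff₀ hδ).2 (by linarith))
    have hl := Real.log_two_gt_d9
    have h1 := le_mul_log_mul_log hd hN hε hε1
    have hll : 0.4 ≤ Real.log 2 * Real.log 2 := by nlinarith
    have hεm : 8 * d ≤ ε * m := by nlinarith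
    have hmd : d + 1 ≤ 2 * m * N := by
      have hm8 : (8 * d : ℝ) ≤ m := hεm.trans (mul_le_of_le_one_left (by positivity) hε1.le)
      have : 8 * d ≤ m := by exact_mod_cast hm8
      nlinarith
    have hkc := (Nat.ceil_lt_add_one (a := ε * m / 4) (by positivity)).le
    set G := (Real.exp 1 * (2 * m * N : ℕ) / (d + 1)) ^ (d + 1)
    have hG0 : 0 ≤ G := by positivity
    refine (measureReal_exists_disjoint_le D 𝓑 ⌊G⌋₊ ⌈ε * m / 4⌉₊ hε (by linarith) hkc
      fun S hS => Nat.le_floor (hgr S _ (Nat.mul_le_mul_right N hS) hmd)).trans ?_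
    refine le_trans ?_ (two_mul_growth_div_two_pow_le hd hN hε hε1 hδ hδ1 hm (Nat.le_ceil _))
    gcongr
    exact Nat.floor_le hG0

end SampleSize

/-! ### From error sets to consistent learning rules -/

section Learning

variable {F : Set Generator} {T : ℕ}

theorem one_sub_le_measureReal_of_imp {D : Measure Str} [IsProbabilityMeasure D] {m : ℕ} {δ : ℝ}
    {bad good : Set (Fin m → Str)} (hbad : (Measure.pi fun _ => D).real bad ≤ δ)
    (h : ∀ x ∉ bad, x ∈ good) : 1 - δ ≤ (Measure.pi fun _ => D).real good := by
  have hcompl := probReal_compl_eq_one_sub (μ := Measure.pi fun _ : Fin m => D)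
    bad.to_countable.measurableSet
  have := measureReal_mono (μ := Measure.pi fun _ : Fin m => D) (s₁ := badᶜ) (s₂ := good) h
  linarith

theorem exists_isE2EConsRule (F : Set Generator) (T : ℕ) : ∃ A, IsE2EConsRule F T A := by
  classical
  refine ⟨fun S => if h : ∃ f ∈ F, E2EConsistent f T S then ete h.choose T else fun _ => false,
    fun S h => ⟨h.choose, h.choose_spec.1, h.choose_spec.2, by simp only [dif_pos h]⟩⟩

theorem exists_isCoTConsRule (F : Set Generator) (T : ℕ) : ∃ A, IsCoTConsRule F T A := by
  classical
  refine ⟨fun S => if h : ∃ f ∈ F, CoTConsistent f T S then ete h.choose T else fun _ => false,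
    fun S h => ⟨h.choose, h.choose_spec.1, h.choose_spec.2, by simp only [dif_pos h]⟩⟩

theorem IsE2EConsRule.e2eLearnsWith {A : E2ERule} (hA : IsE2EConsRule F T A) {m : ℝ → ℝ → ℕ}
    (hm : ∀ (D : Measure Str) [IsProbabilityMeasure D], ∀ f ∈ F, ∀ ε δ : ℝ,
      0 < ε → ε < 1 → 0 < δ → δ < 1 → (Measure.pi fun _ : Fin (m ε δ) => D).real
        {x | ∃ B ∈ eteErrorSets F f T, ε < D.real B ∧ ∀ i, x i ∉ B} ≤ δ) :
    E2ELearnsWith F T A m := by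
  intro D _ f hf ε δ hε hε1 hδ hδ1
  refine one_sub_le_measureReal_of_imp (hm D f hf ε δ hε hε1 hδ hδ1) fun x hx => ?_
  obtain ⟨g, hg, hcons, hAg⟩ := hA (e2eSample f T x) ⟨f, hf, fun p hp => by
    obtain ⟨i, rfl⟩ := (List.mem_ofFn' _ _).1 hp
    rfl⟩
  by_contra hlt
  refine hx ⟨_, ⟨g, hg, rfl⟩, ?_, fun i => ?_⟩
  · simpa [popError, hAg] using hlt
  · simpa using hcons (x i, ete f T (x i)) ((List.mem_ofFn' _ _).2 ⟨i, rfl⟩)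

/-- Consistency makes the sample miss the set where whole chains differ. This set contains the set
of wrong final answers, so it suffices to control the larger one, whose growth is smaller. -/
theorem IsCoTConsRule.coTLearnsWith {A : CoTRule} (hA : IsCoTConsRule F T A) {m : ℝ → ℝ → ℕ}
    (hm : ∀ (D : Measure Str) [IsProbabilityMeasure D], ∀ f ∈ F, ∀ ε δ : ℝ,
      0 < ε → ε < 1 → 0 < δ → δ < 1 → (Measure.pi fun _ : Fin (m ε δ) => D).real
        {x | ∃ B ∈ cotErrorSets F f T, ε < D.real B ∧ ∀ i, x i ∉ B} ≤ δ) :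
    CoTLearnsWith F T A m := by
  intro D _ f hf ε δ hε hε1 hδ hδ1
  refine one_sub_le_measureReal_of_imp (hm D f hf ε δ hε hε1 hδ hδ1) fun x hx => ?_
  obtain ⟨g, hg, hcons, hAg⟩ := hA (cotSample f T x) ⟨f, hf, fun p hp => by
    obtain ⟨i, rfl⟩ := (List.mem_ofFn' _ _).1 hp
    rw [take_length_sub_cot]⟩
  by_contra hlt
  refine hx ⟨_, ⟨g, hg, rfl⟩, ?_, fun i => ?_⟩
  · have herr : ε < D.real {x | ete g T x ≠ ete f T x} := by simpa [popError, hAg] using hlt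
    exact herr.trans_le (measureReal_mono fun x (hx : ete g T x ≠ ete f T x) h =>
      hx (by rw [ete, ete, h]))
  · have := hcons (cot f T (x i)) ((List.mem_ofFn' _ _).2 ⟨i, rfl⟩)
    rw [take_length_sub_cot] at this
    simpa using this.symm

theorem e2eLearnsWith_linClass {d : ℕ} (hd : 1 ≤ d) (hT : 1 ≤ T) {A : E2ERule}
    (hA : IsE2EConsRule (linClass d) T A) :
    E2ELearnsWith (linClass d) T A (sampleSize d (T * 2 ^ T)) :=
  hA.e2eLearnsWith fun D _ f _ _ _ hε hε1 hδ hδ1 =>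
    measureReal_exists_disjoint_sampleSize_le D hd (Nat.mul_pos hT (by positivity)) hε hε1 hδ hδ1
      (finite_image_linClass _ d) (ncard_image_linClass_le_two_pow _ hd)
      (hasGrowth_eteErrorSets f d T)

theorem coTLearnsWith_linClass {d : ℕ} (hd : 1 ≤ d) (hT : 1 ≤ T) {A : CoTRule}
    (hA : IsCoTConsRule (linClass d) T A) :
    CoTLearnsWith (linClass d) T A (sampleSize d T) :=
  hA.coTLearnsWith fun D _ f _ _ _ hε hε1 hδ hδ1 =>
    measureReal_exists_disjoint_sampleSize_le D hd hT hε hε1 hδ hδ1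
      (finite_image_linClass _ d) (ncard_image_linClass_le_two_pow _ hd)
      (hasGrowth_cotErrorSets f d T)

theorem log_two_mul_mul_two_pow_le (hT : 1 ≤ T) : Real.log (2 * (T * 2 ^ T : ℕ)) ≤ 3 * T := by
  have hT' : (1 : ℝ) ≤ T := by exact_mod_cast hT
  have hl := Real.log_two_lt_d9
  have h := Real.log_le_sub_one_of_pos (lt_of_lt_of_le one_pos hT')
  push_cast
  rw [Real.log_mul two_ne_zero (by positivity), Real.log_mul (by positivity) (by positivity),
    Real.log_pow]
  nlinarith

/-- At `N = T * 2 ^ T` the factor `log (2 * N)` is at most `3 * T`, which triples the constant 400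
of `sampleSize_le`. -/
theorem sampleSize_mul_two_pow_le {d : ℕ} {ε δ : ℝ} (hd : 1 ≤ d) (hT : 1 ≤ T) (hε : 0 < ε)
    (hε1 : ε < 1) (hδ : 0 < δ) (hδ1 : δ < 1) : (sampleSize d (T * 2 ^ T) ε δ : ℝ) ≤
      1200 * ((min ((d : ℝ) ^ 2) (d * T * Real.log (2 / ε)) + Real.log (1 / δ)) / ε) := by
  have h0 : 0 ≤ Real.log (1 / δ) := Real.log_nonneg ((le_div_iff₀ hδ).2 (by linarith))
  have hb : 0 ≤ Real.log (2 / ε) :=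
    (Real.log_nonneg one_le_two).trans (log_two_le_log_two_div hε hε1)
  have hmin : min ((d : ℝ) ^ 2) (d * Real.log (2 * (T * 2 ^ T : ℕ)) * Real.log (2 / ε)) ≤
      3 * min ((d : ℝ) ^ 2) (d * T * Real.log (2 / ε)) := by
    rw [mul_min_of_nonneg _ _ (by norm_num : (0 : ℝ) ≤ 3)]
    refine min_le_min (by nlinarith [sq_nonneg (d : ℝ)]) ?_
    calc d * Real.log (2 * (T * 2 ^ T : ℕ)) * Real.log (2 / ε)
        ≤ d * (3 * T) * Real.log (2 / ε) := by gcongr; exact log_two_mul_mul_two_pow_le hT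
      _ = _ := by ring
  refine (sampleSize_le hd (Nat.mul_pos hT (by positivity)) hε hε1 hδ hδ1).trans ?_
  rw [← mul_div_assoc, ← mul_div_assoc]
  gcongr ?_ / ε
  linarith

end Learning

theorem mainTheorem12 :
    (∀ d : ℕ, 1 ≤ d →
      ((restrictToLength (linClass d) d).ncard : ℝ) ≤ (2 * Real.exp 1 * 2 ^ d) ^ (d + 1)) ∧
    (∃ C : ℕ, ∀ d : ℕ, 1 ≤ d →
      (restrictToLength (linClass d) d).ncard ≤ 2 ^ (C * d ^ 2)) ∧
    (∃ C : ℝ, 0 < C ∧ ∀ d T : ℕ, 1 ≤ d → 1 ≤ T → ∃ m : ℝ → ℝ → ℕ,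
      (∀ ε δ : ℝ, 0 < ε → ε < 1 → 0 < δ → δ < 1 →
        (m ε δ : ℝ) ≤
          C * ((min ((d : ℝ) ^ 2) (d * T * Real.log (2 / ε)) + Real.log (1 / δ)) / ε)) ∧
      E2ELearnable (linClass d) T m ∧
      ∀ A : E2ERule, IsE2EConsRule (linClass d) T A → E2ELearnsWith (linClass d) T A m) ∧
    (∃ C : ℝ, 0 < C ∧ ∀ d T : ℕ, 1 ≤ d → 1 ≤ T → ∃ m : ℝ → ℝ → ℕ,
      (∀ ε δ : ℝ, 0 < ε → ε < 1 → 0 < δ → δ < 1 →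
        (m ε δ : ℝ) ≤
          C * ((min ((d : ℝ) ^ 2) (d * Real.log (2 * T) * Real.log (2 / ε)) +
            Real.log (1 / δ)) / ε)) ∧
      CoTLearnable (linClass d) T m ∧
      ∀ A : CoTRule, IsCoTConsRule (linClass d) T A → CoTLearnsWith (linClass d) T A m) := by
  refine ⟨fun d hd => ncard_restrictToLength_linClass_le hd,
    ⟨8, fun d hd => ncard_restrictToLength_linClass_le_two_pow hd⟩,
    ⟨1200, by norm_num, fun d T hd hT => ⟨sampleSize d (T * 2 ^ T),
      fun ε δ hε hε1 hδ hδ1 => sampleSize_mul_two_pow_le hd hT hε hε1 hδ hδ1, ?_,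
      fun A hA => e2eLearnsWith_linClass hd hT hA⟩⟩,
    ⟨400, by norm_num, fun d T hd hT => ⟨sampleSize d T,
      fun ε δ hε hε1 hδ hδ1 => sampleSize_le hd hT hε hε1 hδ hδ1, ?_,
      fun A hA => coTLearnsWith_linClass hd hT hA⟩⟩⟩
  · obtain ⟨A, hA⟩ := exists_isE2EConsRule (linClass d) T
    exact ⟨A, e2eLearnsWith_linClass hd hT hA⟩
  · obtain ⟨A, hA⟩ := exists_isCoTConsRule (linClass d) T
    exact ⟨A, coTLearnsWith_linClass hd hT hA⟩
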